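/- For a function $f$ on $I_1=]-1,1[$ let \[ T_1 f(x)=\sum_{j\in\mathbb Z\setminus\{0\}}\frac{1}{(2j+x)^2}\,f\Big(-\frac{1}{2j+x}\Big),\qquad x\in I_1, \] whenever the series converges absolutely, and let $T_1^j$ denote the $j$-th iterate of $T_1$ ($T_1^0=\mathrm{id}$). For $t\in\,]-1,1]$ and $x\in I_1$ put \[ K_1(t,x)=\frac{t}{1+tx},\qquad k_1(t,x)=K_1(t,x)-T_1K_1(t,\cdot)(x),\qquad k_1^{II}(t,x)=\tfrac12\big(k_1(t,-x)-k_1(t,x)\big). \] Then for every $t\in\,]-1,1[$, every integer $j\ge0$ and every $x\in\,]0,1[$, \[ T_1^j k_1^{II}(t,\cdot)(x)<T_1^j k_1^{II}(1,\cdot)(x), \] and if moreover $t\neq0$, then also \[ 0<T_1^j k_1^{II}(t,\cdot)(x). \] -/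

import Mathlib

noncomputable section

namespace HilbertKernel

/-- The (sub)transfer operator `T₁` of the Gauss-type map `x ↦ {-1/x}₂` on `]-1,1[`, given by the
pointwise formula `T₁ f (x) = ∑_{j ∈ ℤ, j ≠ 0} (2j+x)⁻² f(-1/(2j+x))`.
For `x ∈ ]-1,1[` only values of `f` on `]-1,1[` enter, so `T₁` acts on functions on `]-1,1[`. -/
def T₁ (f : ℝ → ℝ) (x : ℝ) : ℝ :=
  ∑' j : {j : ℤ // j ≠ 0}, 1 / (2 * ((j : ℤ) : ℝ) + x) ^ 2 * f (-1 / (2 * ((j : ℤ) : ℝ) + x))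

/-- The variant `K₁(t,x) = t / (1 + t x)` of the Hilbert kernel. -/
def K₁ (t x : ℝ) : ℝ := t / (1 + t * x)

/-- The dynamically reduced Hilbert kernel `k₁(t,·) = (id - T₁) K₁(t,·)`. -/
def k₁ (t x : ℝ) : ℝ := K₁ t x - T₁ (K₁ t) x

/-- The odd part of the dynamically reduced Hilbert kernel, with the sign convention
`k₁ = k₁ᴵ - k₁ᴵᴵ`, that is, `k₁ᴵᴵ(t,x) = (k₁(t,-x) - k₁(t,x)) / 2`. -/
def k₁II (t x : ℝ) : ℝ := 1 / 2 * (k₁ t (-x) - k₁ t x)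

end HilbertKernel

end

namespace HilbertKernel

open Filter Topology

/-! ### Summation lemmas -/

/-! On odd power series `∑ c n * x ^ (2 * n + 1)` with summable coefficients, `T₁` acts by the
positive matrix `transferMatrix`. Its columns sum to 1, so `∑ c n` is conserved; positivity
preserves strict coefficientwise inequalities. Since `k₁II` is even in `t`, it suffices to take `0 ≤
t < 1`. The upper bound holds because the coefficients at `t` are strictly below those at `1`
(`kernelCoeff_lt_topCoeff`), which every iterate inherits. Positivity rests on total positivity: up
to row and column scalings the matrix is a Hankel matrix of a strictly log-convex sequence, hence
strictly TP2, so it preserves the pattern "positive, then negative" (`SignChange.transferCoeff`).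
With that pattern and a nonnegative coefficient sum the series is positive on `]0,1[`
(`SignChange.pos`). The coefficients of `k₁II t` are `t ^ (2 * k + 2) - S k`, where `S` is the image
of the geometric sequence; their sum is 0. They have the pattern because `S (k + 1) > t ^ 2 * S k`
(`sq_mul_transferCoeff_lt`), a Chebyshev correlation inequality for Laplace densities with
increasing quotient. -/

theorem hasSum_telescope {f : ℕ → ℝ} (hf : Antitone f) (h0 : Tendsto f atTop (𝓝 0)) :
    HasSum (fun j => f j - f (j + 1)) (f 0) := by
  rw [hasSum_iff_tendsto_nat_of_nonneg (fun j => sub_nonneg.2 (hf (Nat.le_succ j)))]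
  simp only [Finset.sum_range_sub']
  simpa using (tendsto_const_nhds (x := f 0)).sub h0

theorem tendsto_two_mul_add_atTop (c : ℝ) :
    Tendsto (fun j : ℕ => 2 * (j : ℝ) + c) atTop atTop :=
  tendsto_atTop_add_const_right _ _ (tendsto_natCast_atTop_atTop.const_mul_atTop (by norm_num))

theorem hasSum_prod_of_nonneg {α β : Type*} {f : α × β → ℝ} (h0 : ∀ p, 0 ≤ f p) {g : α → ℝ}
    (hg : ∀ a, HasSum (fun b => f (a, b)) (g a)) {s : ℝ} (hs : HasSum g s) : HasSum f s := by
  have hsum : Summable f := by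
    rw [summable_prod_of_nonneg (fun p => h0 p)]
    refine ⟨fun a => (hg a).summable, ?_⟩
    convert hs.summable using 2 with a
    exact (hg a).tsum_eq
  have h := hsum.hasSum.prod_fiberwise hg
  rw [hs.unique h]
  exact hsum.hasSum

theorem hasSum_binomial {a x : ℝ} (hx : |x| < a) (m : ℕ) :
    HasSum (fun i : ℕ => ((i + m).choose m : ℝ) * x ^ i / a ^ (i + m + 1))
      (1 / (a - x) ^ (m + 1)) := by
  have ha : 0 < a := (abs_nonneg x).trans_lt hx
  have hr : ‖x / a‖ < 1 := by
    rw [Real.norm_eq_abs, abs_div, abs_of_pos ha]; exact (div_lt_one ha).2 hx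
  have h := (hasSum_choose_mul_geometric_of_norm_lt_one m hr).mul_right (1 / a ^ (m + 1))
  have hax : a - x ≠ 0 := by have := (abs_lt.1 hx).2; linarith
  convert! h using 1
  · ext i
    rw [div_pow, add_assoc i m 1, pow_add a i]
    field_simp
  · rw [one_sub_div ha.ne', div_pow]
    field_simp

theorem hasSum_binomial_odd {a x : ℝ} (hx : |x| < a) (m : ℕ) :
    HasSum (fun k : ℕ => 2 * ((2 * k + 1 + m).choose m : ℝ) * x ^ (2 * k + 1) /
      a ^ (2 * k + 1 + m + 1)) (1 / (a - x) ^ (m + 1) - 1 / (a + x) ^ (m + 1)) := by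
  have h1 := (hasSum_binomial hx m).sub
    (hasSum_binomial (x := -x) (by rwa [abs_neg]) m)
  have hinj : Function.Injective (fun k : ℕ => 2 * k + 1) := fun p q h => by simpa using h
  rw [sub_neg_eq_add, ← hinj.hasSum_iff] at h1
  · convert! h1 using 2 with k
    simp only [Function.comp, (odd_two_mul_add_one k).neg_pow]
    ring
  · intro i hi
    have he : Even i := by
      by_contra h
      obtain ⟨k, hk⟩ := Nat.not_even_iff_odd.1 h
      exact hi ⟨k, hk.symm⟩
    rw [he.neg_pow, sub_self]

theorem hasSum_binomial_even {a x : ℝ} (hx : |x| < a) (m : ℕ) :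
    HasSum (fun n : ℕ => 2 * ((2 * n + 2 + m).choose m : ℝ) * x ^ (2 * n + 2) /
      a ^ (2 * n + 2 + m + 1))
      (1 / (a - x) ^ (m + 1) + 1 / (a + x) ^ (m + 1) - 2 * (1 / a ^ (m + 1))) := by
  have h1 := (hasSum_binomial hx m).add
    (hasSum_binomial (x := -x) (by rwa [abs_neg]) m)
  have hinj : Function.Injective (fun k : ℕ => 2 * k) := fun p q h => by simpa using h
  rw [sub_neg_eq_add, ← hinj.hasSum_iff] at h1
  · have h2 := (hasSum_nat_add_iff' 1).2 h1
    convert! h2 using 1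
    · ext n
      simp only [Function.comp]
      rw [(even_two_mul (n + 1)).neg_pow, mul_add]
      ring
    · simp [Function.comp]; ring
  · intro i hi
    have he : Odd i := by
      by_contra h
      obtain ⟨k, hk⟩ := Nat.not_odd_iff_even.1 h
      exact hi ⟨k, by simp only; omega⟩
    rw [he.neg_pow]
    ring

/-! ### The matrix of `T₁` on odd power series -/

/-- The coefficient of `x ^ (2 * k + 1)` in `(a - x) ^ (-(2 * n + 3)) - (a + x) ^ (-(2 * n + 3))`
for `a = 2 * (j + 1)`. -/
noncomputable def weight (n j k : ℕ) : ℝ :=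
  2 * ((2 * k + 1 + (2 * n + 2)).choose (2 * n + 2) : ℝ) /
    (2 * ((j : ℝ) + 1)) ^ (2 * k + 1 + (2 * n + 2) + 1)

/-- The matrix of `T₁` with respect to the odd monomials. -/
noncomputable def transferMatrix (k n : ℕ) : ℝ := ∑' j, weight n j k

/-- The action of `T₁` on the coefficients of an odd power series. -/
noncomputable def transferCoeff (c : ℕ → ℝ) (k : ℕ) : ℝ := ∑' n, transferMatrix k n * c n

/-- `f` is given on `]-1,1[` by the odd power series with the summable coefficients `c`. -/
def OddSeries (c : ℕ → ℝ) (f : ℝ → ℝ) : Prop :=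
  Summable c ∧ ∀ x, |x| < 1 → HasSum (fun n => c n * x ^ (2 * n + 1)) (f x)

theorem weight_pos (n j k : ℕ) : 0 < weight n j k := by
  have : 0 < (2 * k + 1 + (2 * n + 2)).choose (2 * n + 2) := Nat.choose_pos (by omega)
  unfold weight
  positivity

theorem hasSum_weight (n j : ℕ) {x : ℝ} (hx : |x| ≤ 1) :
    HasSum (fun k => weight n j k * x ^ (2 * k + 1))
      (1 / (2 * ((j : ℝ) + 1) - x) ^ (2 * n + 3) - 1 / (2 * ((j : ℝ) + 1) + x) ^ (2 * n + 3)) := by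
  have hj : (0 : ℝ) ≤ j := j.cast_nonneg
  convert! hasSum_binomial_odd (a := 2 * ((j : ℝ) + 1)) (x := x) (by linarith) (2 * n + 2) using 2
    with k
  rw [weight]; ring

/-- At `x = 1` the inner sums are differences of consecutive odd reciprocal powers, so the total
telescopes to 1 for every `n`. -/
theorem hasSum_weight_prod (n : ℕ) :
    HasSum (fun p : ℕ × ℕ => weight n p.1 p.2) 1 := by
  refine hasSum_prod_of_nonneg (fun p => (weight_pos _ _ _).le)
    (fun j => by simpa using hasSum_weight n j (x := 1) (by simp)) ?_
  have h := hasSum_telescope (f := fun j : ℕ => 1 / (2 * (j : ℝ) + 1) ^ (2 * n + 3)) ?_ ?_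
  · convert! h using 2 with j
    · push_cast; ring_nf
    · simp
  · intro i j hij
    have : (i : ℝ) ≤ j := by exact_mod_cast hij
    dsimp only
    gcongr
  · simpa only [one_div, Function.comp_def] using
      tendsto_inv_atTop_zero.comp ((tendsto_pow_atTop (by omega : 2 * n + 3 ≠ 0)).comp
        (tendsto_two_mul_add_atTop 1))

theorem summable_weight (n k : ℕ) : Summable (fun j => weight n j k) :=
  (hasSum_weight_prod n).summable.prod_symm.prod_factor k

theorem hasSum_transferMatrix (n : ℕ) : HasSum (fun k => transferMatrix k n) 1 :=
  (((Equiv.prodComm ℕ ℕ).hasSum_iff).2 (hasSum_weight_prod n)).prod_fiberwise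
    (fun k => (summable_weight n k).hasSum)

theorem transferMatrix_pos (k n : ℕ) : 0 < transferMatrix k n :=
  (summable_weight n k).tsum_pos (fun j => (weight_pos n j k).le) 0 (weight_pos n 0 k)

theorem transferMatrix_le_one (k n : ℕ) : transferMatrix k n ≤ 1 :=
  le_hasSum (hasSum_transferMatrix n) k (fun i _ => (transferMatrix_pos i n).le)

theorem summable_transferMatrix_mul {c : ℕ → ℝ} (hc : Summable c) (k : ℕ) :
    Summable (fun n => transferMatrix k n * c n) := by
  refine Summable.of_norm_bounded hc.norm (fun n => ?_)
  rw [norm_mul, Real.norm_of_nonneg (transferMatrix_pos k n).le]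
  exact mul_le_of_le_one_left (norm_nonneg _) (transferMatrix_le_one k n)

/-- Absolute summability of the triple series behind the action of `T₁` on power series. -/
theorem summable_triple {c : ℕ → ℝ} (hc : Summable c) {x : ℝ} (hx : |x| ≤ 1) :
    Summable (fun p : ℕ × ℕ × ℕ => c p.1 * (weight p.1 p.2.1 p.2.2 * x ^ (2 * p.2.2 + 1))) := by
  have h : HasSum (fun p : ℕ × ℕ × ℕ => |c p.1| * weight p.1 p.2.1 p.2.2) (∑' n, |c n|) :=
    hasSum_prod_of_nonneg (fun p => mul_nonneg (abs_nonneg _) (weight_pos _ _ _).le)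
      (fun n => by simpa using (hasSum_weight_prod n).mul_left |c n|) hc.abs.hasSum
  refine Summable.of_norm_bounded h.summable (fun p => ?_)
  rw [norm_mul, norm_mul, norm_pow, Real.norm_of_nonneg (weight_pos _ _ _).le, Real.norm_eq_abs,
    Real.norm_eq_abs]
  gcongr
  exact mul_le_of_le_one_right (weight_pos _ _ _).le (pow_le_one₀ (abs_nonneg _) hx)

theorem hasSum_transferCoeff {c : ℕ → ℝ} (hc : Summable c) {x : ℝ} (hx : |x| ≤ 1) :
    HasSum (fun k => transferCoeff c k * x ^ (2 * k + 1))
      (∑' p : ℕ × ℕ × ℕ, c p.1 * (weight p.1 p.2.1 p.2.2 * x ^ (2 * p.2.2 + 1))) := by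
  have h := (summable_triple hc hx).hasSum
  -- Puts `k` outermost. In `OddSeries.T₁` the same triple sum is taken with `j` outermost and
  -- yields `T₁ f x`.
  let e : ℕ × ℕ × ℕ ≃ ℕ × ℕ × ℕ :=
    ⟨fun q => (q.2.1, q.2.2, q.1), fun p => (p.2.2, p.1, p.2.1), fun _ => rfl, fun _ => rfl⟩
  have h' := e.hasSum_iff.2 h
  have hk : ∀ k, HasSum (fun q : ℕ × ℕ => c q.1 * (weight q.1 q.2 k * x ^ (2 * k + 1)))
      (transferCoeff c k * x ^ (2 * k + 1)) := by
    intro k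
    have hs : Summable (fun q : ℕ × ℕ => c q.1 * (weight q.1 q.2 k * x ^ (2 * k + 1))) :=
      h'.summable.prod_factor k
    have h2 := hs.hasSum.prod_fiberwise
      (fun n => (((summable_weight n k).hasSum.mul_right (x ^ (2 * k + 1))).mul_left (c n)))
    have h3 := (summable_transferMatrix_mul hc k).hasSum.mul_right (x ^ (2 * k + 1))
    have h4 := h2.unique (by convert! h3 using 2 with n; rw [transferMatrix]; ring)
    rw [transferCoeff, ← h4]
    exact hs.hasSum
  exact h'.prod_fiberwise hk

theorem hasSum_transferCoeff_sum {c : ℕ → ℝ} (hc : Summable c) :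
    HasSum (transferCoeff c) (∑' n, c n) := by
  have h := hasSum_transferCoeff hc (x := 1) (by simp)
  have h2 := (summable_triple hc (x := 1) (by simp)).hasSum.prod_fiberwise
    (fun n => by simpa using (hasSum_weight_prod n).mul_left (c n))
  rw [h2.tsum_eq]
  simpa using h

/-! ### The operator `T₁` -/

theorem abs_le_abs_two_mul_add {x : ℝ} (hx : |x| < 1) (j : {j : ℤ // j ≠ 0}) :
    |((j : ℤ) : ℝ)| ≤ |2 * ((j : ℤ) : ℝ) + x| := by
  have h1 : (1 : ℝ) ≤ |((j : ℤ) : ℝ)| := by exact_mod_cast Int.one_le_abs j.2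
  have h2 := abs_sub_abs_le_abs_sub (2 * ((j : ℤ) : ℝ)) (-x)
  rw [abs_mul, abs_neg, abs_two, sub_neg_eq_add] at h2
  linarith

theorem two_sub_le_abs {x : ℝ} (j : {j : ℤ // j ≠ 0}) :
    2 - |x| ≤ |2 * ((j : ℤ) : ℝ) + x| := by
  have h1 : (1 : ℝ) ≤ |((j : ℤ) : ℝ)| := by exact_mod_cast Int.one_le_abs j.2
  have h2 := abs_sub_abs_le_abs_sub (2 * ((j : ℤ) : ℝ)) (-x)
  rw [abs_mul, abs_neg, abs_two, sub_neg_eq_add] at h2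
  linarith

theorem abs_branch_le {x : ℝ} (hx : |x| < 1) (j : {j : ℤ // j ≠ 0}) :
    |-1 / (2 * ((j : ℤ) : ℝ) + x)| ≤ 1 / (2 - |x|) := by
  rw [abs_div, abs_neg, abs_one]
  exact one_div_le_one_div_of_le (by linarith) (two_sub_le_abs j)

/-- For fixed `x` all branches land in the compact interval `|y| ≤ 1 / (2 - |x|) < 1`, so a bound
there suffices; this covers `K₁ 1`, which is unbounded near `-1`. -/
theorem summable_T₁ {f : ℝ → ℝ} {x C : ℝ} (hx : |x| < 1)
    (hC : ∀ y, |y| ≤ 1 / (2 - |x|) → |f y| ≤ C) :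
    Summable (fun j : {j : ℤ // j ≠ 0} =>
      1 / (2 * ((j : ℤ) : ℝ) + x) ^ 2 * f (-1 / (2 * ((j : ℤ) : ℝ) + x))) := by
  have h := ((Real.summable_one_div_int_pow (p := 2)).2 (by norm_num)).subtype {j : ℤ | j ≠ 0}
  refine Summable.of_norm_bounded (h.mul_right C) (fun j => ?_)
  have hj : (0 : ℝ) < |((j : ℤ) : ℝ)| := by
    rw [abs_pos]; exact_mod_cast j.2
  rw [norm_mul, Real.norm_of_nonneg (by positivity), Real.norm_eq_abs, ← sq_abs]
  simp only [Function.comp, ← sq_abs ((j : ℤ) : ℝ)]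
  exact mul_le_mul (one_div_le_one_div_of_le (by positivity)
    (pow_le_pow_left₀ hj.le (abs_le_abs_two_mul_add hx j) 2)) (hC _ (abs_branch_le hx j))
    (abs_nonneg _) (by positivity)

theorem hasSum_T₁ {f : ℝ → ℝ} {x C : ℝ} (hx : |x| < 1)
    (hC : ∀ y, |y| ≤ 1 / (2 - |x|) → |f y| ≤ C) (hodd : ∀ y, |y| < 1 → f (-y) = -f y) :
    HasSum (fun j : ℕ => 1 / (2 * ((j : ℝ) + 1) - x) ^ 2 * f (1 / (2 * ((j : ℝ) + 1) - x)) -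
      1 / (2 * ((j : ℝ) + 1) + x) ^ 2 * f (1 / (2 * ((j : ℝ) + 1) + x))) (T₁ f x) := by
  have h := (summable_T₁ hx hC).hasSum
  set F : ℤ → ℝ := fun j => 1 / (2 * (j : ℝ) + x) ^ 2 * f (-1 / (2 * (j : ℝ) + x)) with hF
  have h1 : HasSum (Set.indicator {j : ℤ | j ≠ 0} F) (T₁ f x) :=
    hasSum_subtype_iff_indicator.1 h
  -- Pairs `j` with `-j` and drops index 0, where the indicator vanishes.
  have h2 := (hasSum_nat_add_iff' 1).2 h1.nat_add_neg
  convert! h2 using 1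
  · ext j
    have hj : (0 : ℝ) ≤ j := j.cast_nonneg
    have hj1 : ((j + 1 : ℕ) : ℤ) ≠ 0 := by omega
    obtain ⟨hx1, hx2⟩ := abs_lt.1 hx
    rw [Set.indicator_of_mem (show ((j + 1 : ℕ) : ℤ) ∈ {j : ℤ | j ≠ 0} from hj1),
      Set.indicator_of_mem (show -((j + 1 : ℕ) : ℤ) ∈ {j : ℤ | j ≠ 0} from neg_ne_zero.2 hj1)]
    simp only [hF]
    push_cast
    have e1 : -1 / (2 * -((j : ℝ) + 1) + x) = 1 / (2 * ((j : ℝ) + 1) - x) := by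
      rw [show 2 * -((j : ℝ) + 1) + x = -(2 * ((j : ℝ) + 1) - x) by ring, neg_div_neg_eq]
    have e2 : -1 / (2 * ((j : ℝ) + 1) + x) = -(1 / (2 * ((j : ℝ) + 1) + x)) := by ring
    rw [e1, e2, hodd]
    · ring
    · have hpos : 0 < 2 * ((j : ℝ) + 1) + x := by linarith
      rw [abs_of_pos (by positivity), div_lt_one hpos]
      linarith
  · simp

theorem OddSeries.abs_le {c : ℕ → ℝ} {f : ℝ → ℝ} (h : OddSeries c f) {x : ℝ} (hx : |x| < 1) :
    |f x| ≤ ∑' n, |c n| := by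
  rw [← (h.2 x hx).tsum_eq, ← Real.norm_eq_abs]
  refine tsum_of_norm_bounded h.1.abs.hasSum (fun n => ?_)
  rw [norm_mul, norm_pow, Real.norm_eq_abs, Real.norm_eq_abs]
  exact mul_le_of_le_one_right (abs_nonneg _) (pow_le_one₀ (abs_nonneg _) hx.le)

theorem OddSeries.neg {c : ℕ → ℝ} {f : ℝ → ℝ} (h : OddSeries c f) {x : ℝ} (hx : |x| < 1) :
    f (-x) = -f x := by
  refine (h.2 (-x) (by rwa [abs_neg])).unique ?_
  convert! (h.2 x hx).neg using 2 with n
  rw [(odd_two_mul_add_one n).neg_pow]; ring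

theorem branch_lt_one {x : ℝ} (hx : |x| < 1) : 1 / (2 - |x|) < 1 := by
  rw [div_lt_one] <;> linarith

theorem OddSeries.T₁ {c : ℕ → ℝ} {f : ℝ → ℝ} (h : OddSeries c f) :
    OddSeries (transferCoeff c) (T₁ f) := by
  refine ⟨(hasSum_transferCoeff_sum h.1).summable, fun x hx => ?_⟩
  have hs := hasSum_transferCoeff h.1 hx.le
  have hT := hasSum_T₁ hx (fun y hy => h.abs_le (hy.trans_lt (branch_lt_one hx))) (fun y => h.neg)
  let e : ℕ × ℕ × ℕ ≃ ℕ × ℕ × ℕ :=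
    ⟨fun q => (q.2.1, q.1, q.2.2), fun p => (p.2.1, p.1, p.2.2), fun _ => rfl, fun _ => rfl⟩
  have h' := e.hasSum_iff.2 (summable_triple h.1 hx.le).hasSum
  obtain ⟨hx1, hx2⟩ := abs_lt.1 hx
  have hj : ∀ j : ℕ, HasSum (fun q : ℕ × ℕ => c q.1 * (weight q.1 j q.2 * x ^ (2 * q.2 + 1)))
      (1 / (2 * ((j : ℝ) + 1) - x) ^ 2 * f (1 / (2 * ((j : ℝ) + 1) - x)) -
      1 / (2 * ((j : ℝ) + 1) + x) ^ 2 * f (1 / (2 * ((j : ℝ) + 1) + x))) := by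
    intro j
    have hj0 : (0 : ℝ) ≤ j := j.cast_nonneg
    have hs : Summable (fun q : ℕ × ℕ => c q.1 * (weight q.1 j q.2 * x ^ (2 * q.2 + 1))) :=
      h'.summable.prod_factor j
    have h2 := hs.hasSum.prod_fiberwise (fun n => (hasSum_weight n j hx.le).mul_left (c n))
    have hlt : ∀ y : ℝ, 1 < y → |1 / y| < 1 := fun y hy => by
      rw [abs_of_pos (by positivity)]; exact (div_lt_one (by linarith)).2 hy
    have h3 := ((h.2 _ (hlt (2 * ((j : ℝ) + 1) - x) (by linarith))).mul_left
        (1 / (2 * ((j : ℝ) + 1) - x) ^ 2)).sub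
      ((h.2 _ (hlt (2 * ((j : ℝ) + 1) + x) (by linarith))).mul_left
        (1 / (2 * ((j : ℝ) + 1) + x) ^ 2))
    have h4 := h2.unique (by
      convert! h3 using 2 with n
      simp only [one_div, ← inv_pow]
      ring)
    rw [← h4]
    exact hs.hasSum
  rw [hT.unique (h'.prod_fiberwise hj)]
  exact hs

/-! ### Strict total positivity of order two -/

/-- The sum `∑ 1 / (2 j) ^ (2 i + 4)` over the positive integers `j`. -/
noncomputable def evenZeta (i : ℕ) : ℝ := ∑' j : ℕ, 1 / (2 * ((j : ℝ) + 1)) ^ (2 * i + 4)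

theorem summable_evenZeta (i : ℕ) :
    Summable (fun j : ℕ => 1 / (2 * ((j : ℝ) + 1)) ^ (2 * i + 4)) := by
  have hpos : 0 < (2 * i + 1 + (2 * 0 + 2)).choose (2 * 0 + 2) := Nat.choose_pos (by omega)
  convert! (summable_weight 0 i).mul_left
    (1 / (2 * ((2 * i + 1 + (2 * 0 + 2)).choose (2 * 0 + 2) : ℝ))) using 2 with j
  rw [weight]
  field_simp

theorem evenZeta_pos (i : ℕ) : 0 < evenZeta i :=
  (summable_evenZeta i).tsum_pos (fun j => by positivity) 0 (by positivity)

/-- Cauchy–Schwarz, through nonnegativity of `∑ w * (l - s) ^ 2` at the minimising `l`. -/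
theorem evenZeta_sq_le (i : ℕ) : evenZeta (i + 1) ^ 2 ≤ evenZeta i * evenZeta (i + 2) := by
  have h0 := evenZeta_pos i
  set l := evenZeta (i + 1) / evenZeta i with hl
  have h := (((summable_evenZeta i).hasSum.mul_left (l ^ 2)).sub
    ((summable_evenZeta (i + 1)).hasSum.mul_left (2 * l))).add (summable_evenZeta (i + 2)).hasSum
  have hn := h.nonneg (fun j => by
    have : l ^ 2 * (1 / (2 * ((j : ℝ) + 1)) ^ (2 * i + 4)) -
        2 * l * (1 / (2 * ((j : ℝ) + 1)) ^ (2 * (i + 1) + 4)) +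
        1 / (2 * ((j : ℝ) + 1)) ^ (2 * (i + 2) + 4) =
        1 / (2 * ((j : ℝ) + 1)) ^ (2 * i + 4) * (l - 1 / (2 * ((j : ℝ) + 1)) ^ 2) ^ 2 := by
      field_simp
      ring
    rw [this]
    positivity)
  change 0 ≤ l ^ 2 * evenZeta i - 2 * l * evenZeta (i + 1) + evenZeta (i + 2) at hn
  have e : l * evenZeta i = evenZeta (i + 1) := div_mul_cancel₀ _ h0.ne'
  nlinarith

/-- The Hankel part of the matrix of `T₁`. -/
noncomputable def hankel (i : ℕ) : ℝ := ((2 * i + 3).factorial : ℝ) * evenZeta i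

theorem hankel_pos (i : ℕ) : 0 < hankel i :=
  mul_pos (by exact_mod_cast Nat.factorial_pos _) (evenZeta_pos i)

/-- Strictness comes from the factorials: their successive quotients `P` and `(2 * i + 7) * (2 * i +
6)` strictly increase. -/
theorem hankel_sq_lt (i : ℕ) : hankel (i + 1) ^ 2 < hankel i * hankel (i + 2) := by
  have h := evenZeta_sq_le i
  have hp := mul_pos (evenZeta_pos i) (evenZeta_pos (i + 2))
  have hf : (0 : ℝ) < ((2 * i + 3).factorial : ℝ) := by exact_mod_cast Nat.factorial_pos _
  have e1 : ((2 * (i + 1) + 3).factorial : ℝ) =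
      (2 * i + 5) * (2 * i + 4) * ((2 * i + 3).factorial : ℝ) := by
    rw [show 2 * (i + 1) + 3 = 2 * i + 3 + 1 + 1 by ring, Nat.factorial_succ, Nat.factorial_succ]
    push_cast; ring
  have e2 : ((2 * (i + 2) + 3).factorial : ℝ) =
      (2 * i + 7) * (2 * i + 6) * ((2 * i + 5) * (2 * i + 4) * ((2 * i + 3).factorial : ℝ)) := by
    rw [← e1, show 2 * (i + 2) + 3 = 2 * (i + 1) + 3 + 1 + 1 by ring, Nat.factorial_succ,
      Nat.factorial_succ]
    push_cast; ring
  simp only [hankel, e1, e2]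
  set F := ((2 * i + 3).factorial : ℝ)
  have hi : (0 : ℝ) ≤ i := i.cast_nonneg
  set P := ((2 * i + 5) * (2 * i + 4) : ℝ) with hP
  have hPp : 0 < P := by positivity
  have hPQ : P < (2 * i + 7) * (2 * i + 6) := by rw [hP]; nlinarith
  calc (P * F * evenZeta (i + 1)) ^ 2 = P * F ^ 2 * (P * evenZeta (i + 1) ^ 2) := by ring
    _ ≤ P * F ^ 2 * (P * (evenZeta i * evenZeta (i + 2))) := by gcongr
    _ < P * F ^ 2 * (((2 * i + 7) * (2 * i + 6)) * (evenZeta i * evenZeta (i + 2))) := by gcongr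
    _ = _ := by ring

theorem transferMatrix_eq (k n : ℕ) : transferMatrix k n =
    2 / (((2 * k + 1).factorial : ℝ) * ((2 * n + 2).factorial : ℝ)) * hankel (n + k) := by
  have h1 : transferMatrix k n =
      2 * ((2 * k + 1 + (2 * n + 2)).choose (2 * n + 2) : ℝ) * evenZeta (n + k) := by
    rw [transferMatrix, evenZeta, ← tsum_mul_left]
    congr 1; ext j
    rw [weight, show 2 * k + 1 + (2 * n + 2) + 1 = 2 * (n + k) + 4 by ring]
    ring
  rw [h1, Nat.choose_symm_add.symm, Nat.cast_add_choose, hankel,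
    show 2 * k + 1 + (2 * n + 2) = 2 * (n + k) + 3 by ring]
  ring

theorem strictMono_hankel_ratio : StrictMono (fun i => hankel (i + 1) / hankel i) := by
  refine strictMono_nat_of_lt_succ (fun i => ?_)
  rw [div_lt_div_iff₀ (hankel_pos _) (hankel_pos _)]
  have := hankel_sq_lt i
  nlinarith

/-- This is strict TP2 for adjacent rows; the scalings in `transferMatrix_eq` contribute only a
factor independent of `n`. -/
theorem strictMono_transferMatrix_ratio (k : ℕ) :
    StrictMono (fun n => transferMatrix (k + 1) n / transferMatrix k n) := by
  have e : ∀ n, transferMatrix (k + 1) n / transferMatrix k n =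
      (((2 * k + 1).factorial : ℝ) / ((2 * (k + 1) + 1).factorial : ℝ)) *
        (hankel (n + k + 1) / hankel (n + k)) := by
    intro n
    have h := hankel_pos (n + k)
    rw [transferMatrix_eq, transferMatrix_eq, ← add_assoc]
    have := Nat.factorial_ne_zero (2 * n + 2)
    have := Nat.factorial_ne_zero (2 * k + 1)
    have := Nat.factorial_ne_zero (2 * (k + 1) + 1)
    field_simp
  intro n n' hn
  simp only [e]
  have := strictMono_hankel_ratio (add_lt_add_left hn k)
  have h1 := Nat.factorial_pos (2 * k + 1)
  have h2 := Nat.factorial_pos (2 * (k + 1) + 1)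
  exact mul_lt_mul_of_pos_left this (by positivity)

/-! ### Coefficient sequences with one sign change -/

/-- Once a term is nonpositive, all later terms are negative. -/
def SignChange (c : ℕ → ℝ) : Prop := ∀ n, c n ≤ 0 → c (n + 1) < 0

theorem SignChange.neg_of_lt {c : ℕ → ℝ} (h : SignChange c) {m n : ℕ} (hm : c m ≤ 0)
    (hmn : m < n) : c n < 0 := by
  induction n, hmn using Nat.le_induction with
  | base => exact h m hm
  | succ n _ ih => exact h n ih.le

theorem SignChange.pos_or_exists {c : ℕ → ℝ} (h : SignChange c) :
    (∀ n, 0 < c n) ∨ ∃ N, (∀ n < N, 0 < c n) ∧ ∀ n, N < n → c n < 0 := by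
  by_cases hc : ∀ n, 0 < c n
  · exact Or.inl hc
  · push Not at hc
    classical
    exact Or.inr ⟨Nat.find hc, fun n hn => not_le.1 (Nat.find_min hc hn),
      fun n hn => h.neg_of_lt (Nat.find_spec hc) hn⟩

theorem transferCoeff_lt {c d : ℕ → ℝ} (hc : Summable c) (hd : Summable d) (h : ∀ n, c n < d n)
    (k : ℕ) : transferCoeff c k < transferCoeff d k :=
  Summable.tsum_lt_tsum (i := 0)
    (fun n => mul_le_mul_of_nonneg_left (h n).le (transferMatrix_pos k n).le)
    (mul_lt_mul_of_pos_left (h 0) (transferMatrix_pos k 0))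
    (summable_transferMatrix_mul hc k) (summable_transferMatrix_mul hd k)

theorem transferCoeff_pos {c : ℕ → ℝ} (hc : Summable c) (h : ∀ n, 0 < c n) (k : ℕ) :
    0 < transferCoeff c k := by
  have := transferCoeff_lt summable_zero hc h k
  simpa [transferCoeff] using this

/-- Variation diminishing: let `r` be the ratio of rows `k + 1` and `k` at the change index `N`. In
row `k + 1` minus `r` times row `k`, the entry and `c n` have opposite signs off `N`, so the image
at `k + 1` is strictly below `r` times the image at `k`. -/
theorem SignChange.transferCoeff {c : ℕ → ℝ} (h : SignChange c) (hc : Summable c) :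
    SignChange (transferCoeff c) := by
  intro k hk
  obtain hpos | ⟨N, hlt, hgt⟩ := h.pos_or_exists
  · exact absurd (transferCoeff_pos hc hpos k) (not_lt.2 hk)
  set r := transferMatrix (k + 1) N / transferMatrix k N with hr
  have hr0 : 0 < r := div_pos (transferMatrix_pos _ _) (transferMatrix_pos _ _)
  have hs := (summable_transferMatrix_mul hc (k + 1)).hasSum.sub
    ((summable_transferMatrix_mul hc k).hasSum.mul_left r)
  have hsign : ∀ n, transferMatrix (k + 1) n * c n - r * (transferMatrix k n * c n) =
      transferMatrix k n * ((transferMatrix (k + 1) n / transferMatrix k n - r) * c n) := by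
    intro n
    have := (transferMatrix_pos k n).ne'
    field_simp
  have hneg : ∀ n, N < n →
      transferMatrix (k + 1) n * c n - r * (transferMatrix k n * c n) < 0 := by
    intro n hn
    rw [hsign]
    exact mul_neg_of_pos_of_neg (transferMatrix_pos k n) (mul_neg_of_pos_of_neg
      (sub_pos.2 (strictMono_transferMatrix_ratio k hn)) (hgt n hn))
  have hlt0 := hasSum_lt (i := N + 1) (fun n => ?_) (hneg (N + 1) (Nat.lt_succ_self N)) hs
    hasSum_zero
  · change HilbertKernel.transferCoeff c (k + 1) - r * HilbertKernel.transferCoeff c k < 0 at hlt0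
    nlinarith
  · rcases lt_trichotomy n N with hn | rfl | hn
    · rw [hsign]
      exact (mul_neg_of_pos_of_neg (transferMatrix_pos k n) (mul_neg_of_neg_of_pos
        (sub_neg.2 (strictMono_transferMatrix_ratio k hn)) (hlt n hn))).le
    · rw [hsign, hr, sub_self]; simp
    · exact (hneg n hn).le

/-- Replacing each `x ^ (2 * n + 1)` by `x ^ (2 * N + 1)` lowers the positive terms and raises the
negative ones, so `f x > x ^ (2 * N + 1) * ∑ c n ≥ 0`. -/
theorem SignChange.pos {c : ℕ → ℝ} {f : ℝ → ℝ} (h : SignChange c) (hf : OddSeries c f)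
    (hc : 0 ≤ ∑' n, c n) {x : ℝ} (hx : x ∈ Set.Ioo (0 : ℝ) 1) : 0 < f x := by
  have hxs := hf.2 x (by rw [abs_of_pos hx.1]; exact hx.2)
  obtain hpos | ⟨N, hlt, hgt⟩ := h.pos_or_exists
  · exact hasSum_lt (i := 0) (fun n => (mul_pos (hpos n) (pow_pos hx.1 _)).le)
      (mul_pos (hpos 0) (pow_pos hx.1 _)) hasSum_zero hxs
  have hs := hxs.sub (hf.1.hasSum.mul_right (x ^ (2 * N + 1)))
  have hgt' : ∀ n, N < n → 0 < c n * x ^ (2 * n + 1) - c n * x ^ (2 * N + 1) := by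
    intro n hn
    have := pow_lt_pow_right_of_lt_one₀ hx.1 hx.2 (show 2 * N + 1 < 2 * n + 1 by omega)
    nlinarith [hgt n hn]
  have hlt0 := hasSum_lt (i := N + 1) (fun n => ?_) (hgt' (N + 1) (Nat.lt_succ_self N))
    hasSum_zero hs
  · have := mul_nonneg hc (pow_pos hx.1 (2 * N + 1)).le
    linarith
  · rcases lt_trichotomy n N with hn | rfl | hn
    · have := pow_le_pow_of_le_one hx.1.le hx.2.le (show 2 * n + 1 ≤ 2 * N + 1 by omega)
      have := mul_le_mul_of_nonneg_left this (hlt n hn).le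
      change 0 ≤ _
      linarith
    · simp
    · exact (hgt' n hn).le

theorem OddSeries.iterate_pos {c : ℕ → ℝ} {f : ℝ → ℝ} (hf : OddSeries c f) (h : SignChange c)
    (hc : 0 ≤ ∑' n, c n) (j : ℕ) {x : ℝ} (hx : x ∈ Set.Ioo (0 : ℝ) 1) :
    0 < (HilbertKernel.T₁^[j] f) x := by
  induction j generalizing c f with
  | zero => exact h.pos hf hc hx
  | succ j ih =>
    rw [Function.iterate_succ_apply]
    exact ih hf.T₁ (h.transferCoeff hf.1) (by rwa [(hasSum_transferCoeff_sum hf.1).tsum_eq])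

theorem OddSeries.iterate_lt {c d : ℕ → ℝ} {f g : ℝ → ℝ} (hf : OddSeries c f)
    (hg : OddSeries d g) (h : ∀ n, c n < d n) (j : ℕ) {x : ℝ} (hx : x ∈ Set.Ioo (0 : ℝ) 1) :
    (HilbertKernel.T₁^[j] f) x < (HilbertKernel.T₁^[j] g) x := by
  induction j generalizing c d f g with
  | zero =>
    have hx' : |x| < 1 := by rw [abs_of_pos hx.1]; exact hx.2
    exact hasSum_lt (i := 0) (fun n => (mul_lt_mul_of_pos_right (h n) (pow_pos hx.1 _)).le)
      (mul_lt_mul_of_pos_right (h 0) (pow_pos hx.1 _)) (hf.2 x hx') (hg.2 x hx')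
  | succ j ih =>
    rw [Function.iterate_succ_apply, Function.iterate_succ_apply]
    exact ih hf.T₁ hg.T₁ (transferCoeff_lt hf.1 hg.1 h)

/-! ### The kernel `k₁II` as an odd power series -/

/-- The odd part `(K₁(t,-x) - K₁(t,x)) / 2`. -/
noncomputable def oddKernel (t x : ℝ) : ℝ := t ^ 2 * x / (1 - t ^ 2 * x ^ 2)

theorem abs_K₁_le {t x y : ℝ} (ht : |t| ≤ 1) (hx : |x| < 1) (hy : |y| ≤ 1 / (2 - |x|)) :
    |K₁ t y| ≤ 1 / (1 - 1 / (2 - |x|)) := by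
  have h1 := branch_lt_one hx
  have h2 : |t * y| ≤ 1 / (2 - |x|) := by
    rw [abs_mul]; exact (mul_le_of_le_one_left (abs_nonneg _) ht).trans hy
  have h3 : 1 - 1 / (2 - |x|) ≤ |1 + t * y| := by
    rw [le_abs]; left; linarith [(abs_le.1 h2).1]
  rw [K₁, abs_div]
  exact div_le_div₀ zero_le_one ht (by linarith) h3

theorem oddKernel_eq {t y : ℝ} (ht : |t| ≤ 1) (hy : |y| < 1) :
    oddKernel t y = 1 / 2 * (K₁ t (-y) - K₁ t y) := by
  have h : |t * y| < 1 := by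
    rw [abs_mul]; exact (mul_le_of_le_one_left (abs_nonneg _) ht).trans_lt hy
  obtain ⟨h1, h2⟩ := abs_lt.1 h
  have e1 : 1 + t * -y ≠ 0 := by linarith
  have e2 : 1 + t * y ≠ 0 := by linarith
  have e3 : 1 - t ^ 2 * y ^ 2 ≠ 0 := by
    rw [show 1 - t ^ 2 * y ^ 2 = (1 + t * -y) * (1 + t * y) by ring]; exact mul_ne_zero e1 e2
  rw [oddKernel, K₁, K₁, div_sub_div _ _ e1 e2, show (1 + t * -y) * (1 + t * y) =
    1 - t ^ 2 * y ^ 2 by ring]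
  field_simp
  ring

theorem T₁_neg (f : ℝ → ℝ) (x : ℝ) : T₁ f (-x) = T₁ (fun y => f (-y)) x := by
  let e : {j : ℤ // j ≠ 0} ≃ {j : ℤ // j ≠ 0} :=
    (Equiv.neg ℤ).subtypeEquiv (fun a => by simp)
  rw [T₁, T₁, ← e.tsum_eq]
  congr 1; ext j
  have : ((e j : ℤ) : ℝ) = -((j : ℤ) : ℝ) := by simp [e]
  rw [this, show 2 * -((j : ℤ) : ℝ) + -x = -(2 * ((j : ℤ) : ℝ) + x) by ring, neg_sq, div_neg]

/-- `T₁` commutes with reflection, so taking odd parts commutes with `id - T₁`. -/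
theorem k₁II_eq {t x : ℝ} (ht : |t| ≤ 1) (hx : |x| < 1) :
    k₁II t x = oddKernel t x - T₁ (oddKernel t) x := by
  have h1 := (summable_T₁ hx (fun y hy => abs_K₁_le (t := t) ht hx hy)).hasSum
  have h2 := (summable_T₁ (f := fun y => K₁ t (-y)) hx
    (fun y hy => abs_K₁_le (y := -y) ht hx (by rwa [abs_neg]))).hasSum
  have h : T₁ (oddKernel t) x = 1 / 2 * (T₁ (fun y => K₁ t (-y)) x - T₁ (K₁ t) x) := by
    rw [T₁]
    convert! ((h2.sub h1).mul_left (1 / 2)).tsum_eq using 3 with j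
    rw [oddKernel_eq ht ((abs_branch_le hx j).trans_lt (branch_lt_one hx))]
    ring
  rw [h, oddKernel_eq ht hx, k₁II, k₁, k₁, T₁_neg]
  ring

theorem k₁II_neg (t x : ℝ) : k₁II (-t) x = k₁II t x := by
  have hK : ∀ y, K₁ (-t) y = -K₁ t (-y) := fun y => by
    rw [K₁, K₁]; ring_nf
  have hT : ∀ y, T₁ (K₁ (-t)) y = -T₁ (K₁ t) (-y) := fun y => by
    rw [T₁_neg, T₁, T₁, ← tsum_neg]
    simp only [hK, mul_neg]
  simp only [k₁II, k₁, hK, hT, neg_neg]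
  ring

theorem oddSeries_oddKernel {t : ℝ} (h0 : 0 ≤ t) (h1 : t < 1) :
    OddSeries (fun n => t ^ (2 * n + 2)) (oddKernel t) := by
  constructor
  · convert! (summable_geometric_of_lt_one (sq_nonneg t)
      (pow_lt_one₀ h0 h1 two_ne_zero)).mul_right (t ^ 2) using 2 with n
    rw [pow_add, pow_mul]
  · intro x hx
    have h : t ^ 2 * x ^ 2 < 1 := by
      have ht2 : t ^ 2 < 1 := pow_lt_one₀ h0 h1 two_ne_zero
      have hx2 : x ^ 2 < 1 := (sq_lt_one_iff_abs_lt_one x).2 hx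
      nlinarith [sq_nonneg t, sq_nonneg x]
    rw [oddKernel, div_eq_mul_inv]
    convert! (hasSum_geometric_of_lt_one (by positivity) h).mul_left (t ^ 2 * x) using 2 with n
    dsimp only
    rw [pow_add, pow_mul, pow_succ x, pow_mul, mul_pow]
    ring

/-- The coefficients of `k₁II t` for `0 ≤ t < 1`. -/
noncomputable def kernelCoeff (t : ℝ) (k : ℕ) : ℝ :=
  t ^ (2 * k + 2) - transferCoeff (fun n => t ^ (2 * n + 2)) k

theorem oddSeries_k₁II {t : ℝ} (h0 : 0 ≤ t) (h1 : t < 1) :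
    OddSeries (kernelCoeff t) (k₁II t) := by
  have h := oddSeries_oddKernel h0 h1
  refine ⟨h.1.sub h.T₁.1, fun x hx => ?_⟩
  rw [k₁II_eq (by rw [abs_of_nonneg h0]; exact h1.le) hx]
  convert! (h.2 x hx).sub (h.T₁.2 x hx) using 2 with n
  rw [kernelCoeff]; ring

theorem tsum_kernelCoeff {t : ℝ} (h0 : 0 ≤ t) (h1 : t < 1) : ∑' k, kernelCoeff t k = 0 := by
  have h := oddSeries_oddKernel h0 h1
  exact (h.1.hasSum.sub (hasSum_transferCoeff_sum h.1)).tsum_eq.trans (sub_self _)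

/-- Summing over `n` before `j` turns the double series into binomial series in `t`; the missing
constant term gives the `-2`. -/
theorem hasSum_transferCoeff_geometric {t : ℝ} (h0 : 0 ≤ t) (h1 : t < 1) (k : ℕ) :
    HasSum (fun j : ℕ => 1 / (2 * ((j : ℝ) + 1) - t) ^ (2 * k + 2) +
      1 / (2 * ((j : ℝ) + 1) + t) ^ (2 * k + 2) - 2 * (1 / (2 * ((j : ℝ) + 1)) ^ (2 * k + 2)))
      (transferCoeff (fun n => t ^ (2 * n + 2)) k) := by
  set e : ℕ → ℝ := fun n => t ^ (2 * n + 2) with he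
  have hs : HasSum (fun n => transferMatrix k n * e n) (transferCoeff e k) :=
    (summable_transferMatrix_mul (oddSeries_oddKernel h0 h1).1 k).hasSum
  have he0 : ∀ n, 0 ≤ e n := fun n => pow_nonneg h0 (2 * n + 2)
  have hp : HasSum (fun p : ℕ × ℕ => weight p.1 p.2 k * e p.1) (transferCoeff e k) :=
    hasSum_prod_of_nonneg (fun p => mul_nonneg (weight_pos p.1 p.2 k).le (he0 p.1))
      (fun n => (summable_weight n k).hasSum.mul_right (e n)) hs
  have hq : HasSum (fun p : ℕ × ℕ => weight p.2 p.1 k * e p.2) (transferCoeff e k) :=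
    (Equiv.prodComm ℕ ℕ).hasSum_iff.2 hp
  refine hq.prod_fiberwise (fun j => ?_)
  have hj : (0 : ℝ) ≤ j := j.cast_nonneg
  have hb := hasSum_binomial_even (a := 2 * ((j : ℝ) + 1)) (x := t)
    (by rw [abs_of_nonneg h0]; linarith) (2 * k + 1)
  have hw : ∀ n : ℕ, weight n j k * e n =
      2 * ((2 * n + 2 + (2 * k + 1)).choose (2 * k + 1) : ℝ) * t ^ (2 * n + 2) /
        (2 * ((j : ℝ) + 1)) ^ (2 * n + 2 + (2 * k + 1) + 1) := by
    intro n
    rw [weight, he, Nat.add_comm (2 * k + 1) (2 * n + 2),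
      Nat.choose_symm_add (a := 2 * n + 2) (b := 2 * k + 1)]
    ring
  simp only [hw]
  exact hb

/-! ### The kernel at `t = 1` -/

/-- The double series behind the coefficients of `k₁II 1`. -/
noncomputable def topTerm (j k : ℕ) : ℝ :=
  2 * (1 / (2 * ((j : ℝ) + 1)) ^ (2 * k + 2) - 1 / (2 * ((j : ℝ) + 1) + 1) ^ (2 * k + 2))

/-- The coefficients of `k₁II 1`. -/
noncomputable def topCoeff (k : ℕ) : ℝ := ∑' j, topTerm j k

theorem topTerm_nonneg (j k : ℕ) : 0 ≤ topTerm j k := by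
  refine mul_nonneg zero_le_two (sub_nonneg.2 ?_)
  gcongr
  linarith

theorem hasSum_topTerm (j : ℕ) {x : ℝ} (hx : |x| ≤ 1) :
    HasSum (fun k => topTerm j k * x ^ (2 * k + 1))
      ((1 / (2 * ((j : ℝ) + 1) - x) - 1 / (2 * ((j : ℝ) + 1) + x)) -
        (1 / (2 * ((j : ℝ) + 1) + 1 - x) - 1 / (2 * ((j : ℝ) + 1) + 1 + x))) := by
  have hj : (0 : ℝ) ≤ j := j.cast_nonneg
  have h := (hasSum_binomial_odd (a := 2 * ((j : ℝ) + 1)) (x := x) (by linarith) 0).sub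
    (hasSum_binomial_odd (a := 2 * ((j : ℝ) + 1) + 1) (x := x) (by linarith) 0)
  simp only [Nat.choose_zero_right, zero_add, pow_one, add_zero] at h
  convert! h using 2 with k
  rw [topTerm]
  push_cast
  ring

theorem tendsto_one_div_two_mul_add (c : ℝ) :
    Tendsto (fun j : ℕ => 1 / (2 * (j : ℝ) + c)) atTop (𝓝 0) := by
  simpa only [one_div, Function.comp_def] using
    tendsto_inv_atTop_zero.comp (tendsto_two_mul_add_atTop c)

theorem hasSum_one_div_telescope {c : ℝ} (hc : 0 < c) :
    HasSum (fun j : ℕ => 1 / (2 * (j : ℝ) + c) - 1 / (2 * (j : ℝ) + 2 + c)) (1 / c) := by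
  have h := hasSum_telescope (f := fun j : ℕ => 1 / (2 * (j : ℝ) + c)) (fun i j hij => ?_)
    (tendsto_one_div_two_mul_add c)
  · convert! h using 2 with j
    · push_cast; ring_nf
    · simp
  · have : (i : ℝ) ≤ j := by exact_mod_cast hij
    dsimp only
    gcongr

theorem summable_topTerm_prod : Summable (fun p : ℕ × ℕ => topTerm p.1 p.2) := by
  refine (hasSum_prod_of_nonneg (fun p => topTerm_nonneg _ _)
    (fun j => by simpa only [one_pow, mul_one] using hasSum_topTerm j (x := 1) (by simp))
    (s := 1 / 1 - 1 / 2) ?_).summable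
  convert! (hasSum_one_div_telescope one_pos).sub (hasSum_one_div_telescope two_pos) using 2 with j
  ring_nf

theorem summable_topTerm (k : ℕ) : Summable (fun j => topTerm j k) :=
  summable_topTerm_prod.prod_symm.prod_factor k

theorem summable_topCoeff : Summable topCoeff :=
  (((Equiv.prodComm ℕ ℕ).hasSum_iff).2 summable_topTerm_prod.hasSum).prod_fiberwise
    (fun k => (summable_topTerm k).hasSum) |>.summable

theorem oddKernel_one_neg (y : ℝ) : oddKernel 1 (-y) = -oddKernel 1 y := by
  rw [oddKernel, oddKernel, neg_sq]; ring

theorem abs_oddKernel_one_le {x y : ℝ} (hx : |x| < 1) (hy : |y| ≤ 1 / (2 - |x|)) :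
    |oddKernel 1 y| ≤ 1 / (1 - 1 / (2 - |x|)) := by
  have h1 : |(1 : ℝ)| ≤ 1 := by simp
  rw [oddKernel_eq h1 (hy.trans_lt (branch_lt_one hx)), abs_mul, abs_of_pos (by norm_num)]
  have ha := abs_K₁_le h1 hx hy
  have hb := abs_K₁_le (y := -y) h1 hx (by rwa [abs_neg])
  have := abs_sub (K₁ 1 (-y)) (K₁ 1 y)
  linarith

theorem one_div_sq_mul_oddKernel_one {y : ℝ} (hy : 1 < y) :
    1 / y ^ 2 * oddKernel 1 (1 / y) = 1 / 2 * (1 / (y - 1) + 1 / (y + 1)) - 1 / y := by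
  have h1 : y - 1 ≠ 0 := by linarith
  have h2 : y + 1 ≠ 0 := by linarith
  have h0 : y ≠ 0 := by linarith
  have h3 : y ^ 2 - 1 ≠ 0 := by
    rw [show y ^ 2 - 1 = (y - 1) * (y + 1) by ring]; exact mul_ne_zero h1 h2
  have e : oddKernel 1 (1 / y) = y / (y ^ 2 - 1) := by
    rw [oddKernel, div_eq_div_iff _ h3]
    · field_simp
    · rw [show 1 - 1 ^ 2 * (1 / y) ^ 2 = (y ^ 2 - 1) / y ^ 2 by field_simp]
      exact div_ne_zero h3 (pow_ne_zero 2 h0)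
  rw [e, div_add_div _ _ h1 h2, show (y - 1) * (y + 1) = y ^ 2 - 1 by ring]
  field_simp
  ring

/-- At `t = 1` the coefficients of `oddKernel` are all 1, hence not summable, and the matrix cannot
be applied to them. Instead, partial fractions make the `topTerm` series plus the series for `T₁
(oddKernel 1)` telescope to `oddKernel 1`. -/
theorem oddSeries_k₁II_one : OddSeries topCoeff (k₁II 1) := by
  refine ⟨summable_topCoeff, fun x hx => ?_⟩
  obtain ⟨hx1, hx2⟩ := abs_lt.1 hx
  have hs : Summable (fun p : ℕ × ℕ => topTerm p.1 p.2 * x ^ (2 * p.2 + 1)) := by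
    refine Summable.of_norm_bounded summable_topTerm_prod (fun p => ?_)
    rw [norm_mul, Real.norm_of_nonneg (topTerm_nonneg _ _), norm_pow]
    exact mul_le_of_le_one_right (topTerm_nonneg _ _) (pow_le_one₀ (norm_nonneg _) hx.le)
  have hk := ((Equiv.prodComm ℕ ℕ).hasSum_iff.2 hs.hasSum).prod_fiberwise
    (fun k => (summable_topTerm k).hasSum.mul_right (x ^ (2 * k + 1)))
  have hj := hs.hasSum.prod_fiberwise (fun j => hasSum_topTerm j hx.le)
  have hT := hasSum_T₁ (f := oddKernel 1) hx (fun y hy => abs_oddKernel_one_le hx hy)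
    (fun y _ => oddKernel_one_neg y)
  have hadd := hj.add hT
  have htel : HasSum (fun j : ℕ =>
      1 / 2 * ((1 / (2 * (j : ℝ) + (1 - x)) - 1 / (2 * (j : ℝ) + 2 + (1 - x))) -
        (1 / (2 * (j : ℝ) + (1 + x)) - 1 / (2 * (j : ℝ) + 2 + (1 + x)))))
      (1 / 2 * (1 / (1 - x) - 1 / (1 + x))) :=
    ((hasSum_one_div_telescope (by linarith)).sub
      (hasSum_one_div_telescope (by linarith))).mul_left _
  have hE : oddKernel 1 x = 1 / 2 * (1 / (1 - x) - 1 / (1 + x)) := by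
    rw [oddKernel_eq (by simp) hx, K₁, K₁]; ring_nf
  have huniq := hadd.unique (by
    convert! htel using 2 with j
    have hj : (0 : ℝ) ≤ j := j.cast_nonneg
    rw [one_div_sq_mul_oddKernel_one (by linarith), one_div_sq_mul_oddKernel_one (by linarith)]
    ring_nf)
  rw [k₁II_eq (by simp) hx, ← huniq, add_sub_cancel_right]
  exact hk

/-- Midpoint convexity of a negative power, from AM–GM applied twice. -/
theorem two_mul_one_div_pow_le {a b : ℝ} (ha : 0 < a) (hb : 0 < b) (k : ℕ) :
    2 * (1 / ((a + b) / 2) ^ (2 * k + 2)) ≤ 1 / a ^ (2 * k + 2) + 1 / b ^ (2 * k + 2) := by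
  have h1 : a * b ≤ ((a + b) / 2) ^ 2 := by nlinarith [sq_nonneg (a - b)]
  have h2 : 1 / ((a + b) / 2) ^ (2 * k + 2) ≤ 1 / (a * b) ^ (k + 1) := by
    rw [show 2 * k + 2 = 2 * (k + 1) by ring, pow_mul]
    gcongr
  have h3 : 1 / a ^ (2 * k + 2) + 1 / b ^ (2 * k + 2) - 2 * (1 / (a * b) ^ (k + 1)) =
      (1 / a ^ (k + 1) - 1 / b ^ (k + 1)) ^ 2 := by
    rw [show 2 * k + 2 = (k + 1) * 2 by ring, mul_pow, pow_mul, pow_mul]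
    field_simp
    ring
  nlinarith [sq_nonneg (1 / a ^ (k + 1) - 1 / b ^ (k + 1))]

/-- With `a = 2 * (j + 1)`, convexity at the midpoint `a + 1` of `a + t` and `a + 2 - t` bounds the
summand of `S k + topCoeff k` below by a telescoping difference. The total `1 / (2 - t) ^ (2 * k +
2)` exceeds `t ^ (2 * k + 2)` as `t * (2 - t) < 1`. -/
theorem kernelCoeff_lt_topCoeff {t : ℝ} (h0 : 0 ≤ t) (h1 : t < 1) (k : ℕ) :
    kernelCoeff t k < topCoeff k := by
  have hs := (hasSum_transferCoeff_geometric h0 h1 k).add (summable_topTerm k).hasSum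
  have htel := hasSum_telescope (f := fun j : ℕ => 1 / (2 * (j : ℝ) + (2 - t)) ^ (2 * k + 2))
    (fun i j hij => by
      have : (i : ℝ) ≤ j := by exact_mod_cast hij
      have : (0 : ℝ) < 2 * (i : ℝ) + (2 - t) := by
        have : (0 : ℝ) ≤ i := i.cast_nonneg
        linarith
      dsimp only
      gcongr) (by
      simpa only [one_div, Function.comp_def] using
        tendsto_inv_atTop_zero.comp ((tendsto_pow_atTop (by omega : 2 * k + 2 ≠ 0)).comp
          (tendsto_two_mul_add_atTop (2 - t))))
  have hle := hasSum_le (fun j => ?_) htel hs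
  · have hlt : t ^ (2 * k + 2) < 1 / (2 - t) ^ (2 * k + 2) := by
      rw [lt_div_iff₀ (pow_pos (by linarith) _), ← mul_pow]
      exact pow_lt_one₀ (by nlinarith) (by nlinarith) (by omega)
    simp only [Nat.cast_zero, mul_zero, zero_add] at hle
    change _ ≤ _ + topCoeff k at hle
    rw [kernelCoeff]
    linarith
  · have hj : (0 : ℝ) ≤ j := j.cast_nonneg
    have h := two_mul_one_div_pow_le (a := 2 * ((j : ℝ) + 1) + (2 - t))
      (b := 2 * ((j : ℝ) + 1) + t) (by linarith) (by linarith) k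
    rw [show (2 * ((j : ℝ) + 1) + (2 - t) + (2 * ((j : ℝ) + 1) + t)) / 2 =
      2 * ((j : ℝ) + 1) + 1 by ring] at h
    rw [topTerm, show 2 * (j : ℝ) + (2 - t) = 2 * ((j : ℝ) + 1) - t by ring]
    push_cast
    linarith

/-! ### The sign change of the kernel coefficients -/

open MeasureTheory Set

theorem integrableOn_pow_mul_exp (n : ℕ) {r : ℝ} (hr : 0 < r) :
    IntegrableOn (fun u : ℝ => u ^ n * Real.exp (-(r * u))) (Ioi 0) := by
  have h := integrableOn_rpow_mul_exp_neg_mul_rpow (p := 1) (s := n) (b := r)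
    (by have : (0 : ℝ) ≤ n := n.cast_nonneg
        linarith) one_pos hr
  refine h.congr_fun (fun u _ => ?_) measurableSet_Ioi
  simp [Real.rpow_natCast]

theorem integral_pow_mul_exp (n : ℕ) {r : ℝ} (hr : 0 < r) :
    ∫ u in Ioi (0 : ℝ), u ^ n * Real.exp (-(r * u)) = n.factorial * (1 / r ^ (n + 1)) := by
  have h := Real.integral_rpow_mul_exp_neg_mul_Ioi (a := n + 1) (by positivity) hr
  rw [Real.Gamma_nat_eq_factorial, add_sub_cancel_right] at h
  simp only [Real.rpow_natCast] at h
  rw [h, show (n : ℝ) + 1 = ((n + 1 : ℕ) : ℝ) by push_cast; ring, Real.rpow_natCast, div_pow,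
    one_pow, mul_comm]

/-- The quotient of the Laplace densities of `transferCoeff (fun n => t ^ (2 * n + 2))` and
`fun n => t ^ (2 * n + 2)`. -/
noncomputable def densityRatio (t u : ℝ) : ℝ :=
  Real.exp ((1 - t) ^ 2 / t * u) * (1 - Real.exp (-(t * u))) ^ 2 / (1 - Real.exp (-(2 * u)))

/-- The quotient is a secant slope of the concave function `s ↦ s ^ t` between `exp (-u)` and 1. -/
theorem one_sub_exp_ratio_mono {t u v : ℝ} (h0 : 0 < t) (h1 : t < 1) (hu : 0 < u) (huv : u ≤ v) :
    (1 - Real.exp (-(t * u))) / (1 - Real.exp (-u)) ≤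
      (1 - Real.exp (-(t * v))) / (1 - Real.exp (-v)) := by
  have hv := hu.trans_le huv
  have hlt : ∀ w : ℝ, 0 < w → Real.exp (-w) < 1 := fun w hw => Real.exp_lt_one_iff.2 (by linarith)
  have h := (Real.concaveOn_rpow h0.le h1.le).neg.secant_mono (a := 1) (x := Real.exp (-v))
    (y := Real.exp (-u)) (by simp) (Real.exp_pos _).le (Real.exp_pos _).le (hlt v hv).ne
    (hlt u hu).ne (Real.exp_le_exp.2 (by linarith))
  have e : ∀ w : ℝ, 0 < w → (-Real.exp (-w) ^ t - -(1 : ℝ) ^ t) / (Real.exp (-w) - 1) =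
      -((1 - Real.exp (-(t * w))) / (1 - Real.exp (-w))) := by
    intro w hw
    rw [← Real.exp_mul, Real.one_rpow, show -w * t = -(t * w) by ring, ← div_neg, neg_sub]
    ring_nf
  simp only [Pi.neg_apply] at h
  rw [e v hv, e u hu] at h
  exact neg_le_neg_iff.1 h

/-- Factoring `1 - exp (-2w) = (1 - exp (-w)) * (1 + exp (-w))` leaves three positive monotone
factors, the last one strictly increasing. -/
theorem densityRatio_strictMonoOn {t : ℝ} (h0 : 0 < t) (h1 : t < 1) :
    StrictMonoOn (densityRatio t) (Ioi 0) := by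
  have e : ∀ w : ℝ, 0 < w → densityRatio t w = Real.exp ((1 - t) ^ 2 / t * w) *
      ((1 - Real.exp (-(t * w))) / (1 - Real.exp (-w))) *
      ((1 - Real.exp (-(t * w))) / (1 + Real.exp (-w))) := by
    intro w hw
    have : Real.exp (-(2 * w)) = Real.exp (-w) ^ 2 := by
      rw [← Real.exp_nat_mul]; push_cast; ring_nf
    rw [densityRatio, this, show 1 - Real.exp (-w) ^ 2 =
      (1 - Real.exp (-w)) * (1 + Real.exp (-w)) by ring]
    rw [mul_assoc, div_mul_div_comm, ← mul_div_assoc, ← sq]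
  intro u hu v hv huv
  rw [mem_Ioi] at hu hv
  rw [e u hu, e v hv]
  have hpos : ∀ w : ℝ, 0 < w → 0 < 1 - Real.exp (-w) := fun w hw =>
    sub_pos.2 (Real.exp_lt_one_iff.2 (by linarith))
  have hm := one_sub_exp_ratio_mono h0 h1 hu huv.le
  have hq : (1 - Real.exp (-(t * u))) / (1 + Real.exp (-u)) <
      (1 - Real.exp (-(t * v))) / (1 + Real.exp (-v)) := by
    have : Real.exp (-(t * v)) < Real.exp (-(t * u)) := Real.exp_lt_exp.2 (by nlinarith)
    have : Real.exp (-v) < Real.exp (-u) := Real.exp_lt_exp.2 (by linarith)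
    have := hpos _ (mul_pos h0 hu)
    have := hpos _ (mul_pos h0 hv)
    have := Real.exp_pos (-v)
    exact div_lt_div₀ (by linarith) (by linarith) (by linarith) (by linarith)
  have hE : Real.exp ((1 - t) ^ 2 / t * u) ≤ Real.exp ((1 - t) ^ 2 / t * v) := by gcongr
  have hp1 := div_pos (hpos _ (mul_pos h0 hu)) (hpos u hu)
  have hp2 := div_pos (hpos _ (mul_pos h0 hu)) (show 0 < 1 + Real.exp (-u) by positivity)
  have hp3 := div_pos (hpos _ (mul_pos h0 hv)) (hpos v hv)
  exact mul_lt_mul' (mul_le_mul hE hm hp1.le (Real.exp_pos _).le) hq hp2.le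
    (mul_pos (Real.exp_pos _) hp3)

/-- A geometric series in `exp (-2u)`; the exponents match because `(1 - t) ^ 2 / t = 1 / t - 2 +
t`. -/
theorem hasSum_laplace {t u : ℝ} (h0 : 0 < t) (hu : 0 < u) (m : ℕ) :
    HasSum (fun j : ℕ => u ^ m * Real.exp (-((2 * ((j : ℝ) + 1) - t) * u)) +
      u ^ m * Real.exp (-((2 * ((j : ℝ) + 1) + t) * u)) -
      2 * (u ^ m * Real.exp (-((2 * ((j : ℝ) + 1)) * u))))
      (u ^ m * Real.exp (-(1 / t * u)) * densityRatio t u) := by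
  have hr : Real.exp (-(2 * u)) < 1 := Real.exp_lt_one_iff.2 (by linarith)
  have h := (hasSum_geometric_of_lt_one (Real.exp_pos _).le hr).mul_left
    (u ^ m * (Real.exp (-(2 * u)) * Real.exp (t * u) * (1 - Real.exp (-(t * u))) ^ 2))
  have ht : Real.exp (t * u) * Real.exp (-(t * u)) = 1 := by rw [← Real.exp_add]; simp
  convert! h using 1
  · ext j
    have e1 : Real.exp (-((2 * ((j : ℝ) + 1)) * u)) =
        Real.exp (-(2 * u)) * Real.exp (-(2 * u)) ^ j := by
      rw [← Real.exp_nat_mul, ← Real.exp_add]; ring_nf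
    have e2 : Real.exp (-((2 * ((j : ℝ) + 1) - t) * u)) =
        Real.exp (-((2 * ((j : ℝ) + 1)) * u)) * Real.exp (t * u) := by
      rw [← Real.exp_add]; ring_nf
    have e3 : Real.exp (-((2 * ((j : ℝ) + 1) + t) * u)) =
        Real.exp (-((2 * ((j : ℝ) + 1)) * u)) * Real.exp (-(t * u)) := by
      rw [← Real.exp_add]; ring_nf
    rw [e2, e3, e1]
    linear_combination (-u ^ m * Real.exp (-(2 * u)) * Real.exp (-(2 * u)) ^ j *
      (Real.exp (-(t * u)) - 2)) * ht
  · have e : Real.exp (-(1 / t * u)) * Real.exp ((1 - t) ^ 2 / t * u) =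
        Real.exp (-(2 * u)) * Real.exp (t * u) := by
      rw [← Real.exp_add, ← Real.exp_add]
      congr 1
      field_simp
      ring
    rw [densityRatio, div_eq_mul_inv _ (1 - Real.exp (-(2 * u)))]
    generalize Real.exp (-(1 / t * u)) = A at e ⊢
    linear_combination (u ^ m * (1 - Real.exp (-(t * u))) ^ 2 * (1 - Real.exp (-(2 * u)))⁻¹) * e

theorem integral_densityRatio {t : ℝ} (h0 : 0 < t) (h1 : t < 1) (k : ℕ) :
    ∫ u in Ioi (0 : ℝ), u ^ (2 * k + 1) * Real.exp (-(1 / t * u)) * densityRatio t u =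
      (2 * k + 1).factorial * transferCoeff (fun n => t ^ (2 * n + 2)) k := by
  set F : ℕ → ℝ → ℝ := fun j u => u ^ (2 * k + 1) * Real.exp (-((2 * ((j : ℝ) + 1) - t) * u)) +
      u ^ (2 * k + 1) * Real.exp (-((2 * ((j : ℝ) + 1) + t) * u)) -
      2 * (u ^ (2 * k + 1) * Real.exp (-((2 * ((j : ℝ) + 1)) * u))) with hF
  have hr : ∀ j : ℕ, 0 < 2 * ((j : ℝ) + 1) - t ∧ 0 < 2 * ((j : ℝ) + 1) + t ∧
      0 < 2 * ((j : ℝ) + 1) := fun j => by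
    have : (0 : ℝ) ≤ j := j.cast_nonneg
    refine ⟨?_, ?_, ?_⟩ <;> linarith
  have hi1 := fun j : ℕ => integrableOn_pow_mul_exp (2 * k + 1) (hr j).1
  have hi2 := fun j : ℕ => integrableOn_pow_mul_exp (2 * k + 1) (hr j).2.1
  have hi3 := fun j : ℕ => integrableOn_pow_mul_exp (2 * k + 1) (hr j).2.2
  have hi12 : ∀ j : ℕ, IntegrableOn (fun u : ℝ =>
      u ^ (2 * k + 1) * Real.exp (-((2 * ((j : ℝ) + 1) - t) * u)) +
      u ^ (2 * k + 1) * Real.exp (-((2 * ((j : ℝ) + 1) + t) * u))) (Ioi 0) := fun j =>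
    (hi1 j).add (hi2 j)
  have hint : ∀ j, Integrable (F j) (volume.restrict (Ioi 0)) := fun j =>
    (hi12 j).sub ((hi3 j).const_mul 2)
  have hval : ∀ j, ∫ u in Ioi (0 : ℝ), F j u = (2 * k + 1).factorial *
      (1 / (2 * ((j : ℝ) + 1) - t) ^ (2 * k + 2) + 1 / (2 * ((j : ℝ) + 1) + t) ^ (2 * k + 2) -
        2 * (1 / (2 * ((j : ℝ) + 1)) ^ (2 * k + 2))) := by
    intro j
    simp only [hF]
    rw [integral_sub (hi12 j) ((hi3 j).const_mul 2),
      integral_add (hi1 j) (hi2 j), integral_const_mul, integral_pow_mul_exp _ (hr j).1,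
      integral_pow_mul_exp _ (hr j).2.1, integral_pow_mul_exp _ (hr j).2.2]
    ring
  -- Each `F j u` is a power of `u` times a square, so summable integrals alone justify exchanging
  -- sum and integral.
  have hnonneg : ∀ j, ∀ u ∈ Ioi (0 : ℝ), 0 ≤ F j u := by
    intro j u hu
    have e : F j u = u ^ (2 * k + 1) * (Real.exp (-((2 * ((j : ℝ) + 1) - t) / 2 * u)) -
        Real.exp (-((2 * ((j : ℝ) + 1) + t) / 2 * u))) ^ 2 := by
      have e1 : Real.exp (-((2 * ((j : ℝ) + 1) - t) * u)) =
          Real.exp (-((2 * ((j : ℝ) + 1) - t) / 2 * u)) ^ 2 := by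
        rw [← Real.exp_nat_mul]; push_cast; ring_nf
      have e2 : Real.exp (-((2 * ((j : ℝ) + 1) + t) * u)) =
          Real.exp (-((2 * ((j : ℝ) + 1) + t) / 2 * u)) ^ 2 := by
        rw [← Real.exp_nat_mul]; push_cast; ring_nf
      have e3 : Real.exp (-((2 * ((j : ℝ) + 1)) * u)) =
          Real.exp (-((2 * ((j : ℝ) + 1) - t) / 2 * u)) *
            Real.exp (-((2 * ((j : ℝ) + 1) + t) / 2 * u)) := by
        rw [← Real.exp_add]; ring_nf
      simp only [hF]
      rw [e1, e2, e3]
      ring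
    rw [e]
    exact mul_nonneg (pow_nonneg (le_of_lt hu) _) (sq_nonneg _)
  have hS := (hasSum_transferCoeff_geometric h0.le h1 k).mul_left ((2 * k + 1).factorial : ℝ)
  have hnorm : ∀ j, ∫ u in Ioi (0 : ℝ), ‖F j u‖ = ∫ u in Ioi (0 : ℝ), F j u := fun j =>
    setIntegral_congr_fun measurableSet_Ioi (fun u hu => Real.norm_of_nonneg (hnonneg j u hu))
  have h := hasSum_integral_of_summable_integral_norm hint (by
    simp only [hnorm, hval]
    exact hS.summable)
  simp only [hval] at h
  rw [← h.unique hS]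
  exact setIntegral_congr_fun measurableSet_Ioi
    (fun u hu => (hasSum_laplace h0 hu (2 * k + 1)).tsum_eq.symm)

theorem sq_mul_transferCoeff_lt {t : ℝ} (h0 : 0 < t) (h1 : t < 1) (k : ℕ) :
    t ^ 2 * transferCoeff (fun n => t ^ (2 * n + 2)) k <
      transferCoeff (fun n => t ^ (2 * n + 2)) (k + 1) := by
  set S := transferCoeff (fun n => t ^ (2 * n + 2)) with hSdef
  have hSpos : ∀ i, 0 < S i := fun i =>
    transferCoeff_pos (oddSeries_oddKernel h0.le h1).1 (fun n => pow_pos h0 _) i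
  have hfac : ∀ m : ℕ, (0 : ℝ) < (m.factorial : ℝ) := fun m => by
    exact_mod_cast Nat.factorial_pos m
  have hI : ∀ i, IntegrableOn
      (fun u : ℝ => u ^ (2 * i + 1) * Real.exp (-(1 / t * u)) * densityRatio t u) (Ioi 0) := by
    intro i
    -- A non-integrable function has integral 0 by convention, but the known value is positive.
    by_contra hn
    have := integral_densityRatio h0 h1 i
    rw [integral_undef hn] at this
    exact (mul_pos (hfac _) (hSpos i)).ne this
  have ht' : 0 < 1 / t := by positivity
  have hJ := fun i : ℕ => integrableOn_pow_mul_exp (2 * i + 1) ht'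
  -- This `q` makes the integral of `(u ^ 2 - q) * u ^ (2 * k + 1) * exp (-u / t)` vanish, so
  -- subtracting the constant `densityRatio t v` costs nothing, while with `v = √q` both factors of
  -- `G` change sign at `v`.
  set q : ℝ := (2 * k + 3) * (2 * k + 2) * t ^ 2 with hq
  have hqpos : 0 < q := by positivity
  set v := √q with hv
  have hvpos : 0 < v := Real.sqrt_pos.2 hqpos
  have hvq : v ^ 2 = q := Real.sq_sqrt hqpos.le
  set G : ℝ → ℝ := fun u =>
    (u ^ (2 * (k + 1) + 1) * Real.exp (-(1 / t * u)) * densityRatio t u -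
      q * (u ^ (2 * k + 1) * Real.exp (-(1 / t * u)) * densityRatio t u)) -
    densityRatio t v * (u ^ (2 * (k + 1) + 1) * Real.exp (-(1 / t * u)) -
      q * (u ^ (2 * k + 1) * Real.exp (-(1 / t * u)))) with hG
  have hA : IntegrableOn (fun u : ℝ =>
      u ^ (2 * (k + 1) + 1) * Real.exp (-(1 / t * u)) * densityRatio t u -
        q * (u ^ (2 * k + 1) * Real.exp (-(1 / t * u)) * densityRatio t u)) (Ioi 0) :=
    (hI (k + 1)).sub ((hI k).const_mul q)
  have hB : IntegrableOn (fun u : ℝ => u ^ (2 * (k + 1) + 1) * Real.exp (-(1 / t * u)) -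
      q * (u ^ (2 * k + 1) * Real.exp (-(1 / t * u)))) (Ioi 0) :=
    (hJ (k + 1)).sub ((hJ k).const_mul q)
  have hGint : IntegrableOn G (Ioi 0) := hA.sub (hB.const_mul (densityRatio t v))
  have hfs : ((2 * (k + 1) + 1).factorial : ℝ) =
      (2 * k + 3) * (2 * k + 2) * ((2 * k + 1).factorial : ℝ) := by
    rw [show 2 * (k + 1) + 1 = 2 * k + 1 + 1 + 1 by ring, Nat.factorial_succ, Nat.factorial_succ]
    push_cast; ring
  have hGval : ∫ u in Ioi (0 : ℝ), G u = (2 * k + 3) * (2 * k + 2) *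
      ((2 * k + 1).factorial : ℝ) * (S (k + 1) - t ^ 2 * S k) := by
    simp only [hG]
    rw [integral_sub hA (hB.const_mul _), integral_sub (hI (k + 1)) ((hI k).const_mul q),
      integral_const_mul, integral_const_mul, integral_sub (hJ (k + 1)) ((hJ k).const_mul q),
      integral_const_mul, integral_densityRatio h0 h1, integral_densityRatio h0 h1,
      integral_pow_mul_exp _ ht', integral_pow_mul_exp _ ht', hfs, hq]
    have e : ∀ m : ℕ, 1 / (1 / t) ^ m = t ^ m := fun m => by rw [one_div_pow, one_div_one_div]
    rw [e, e]
    ring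
  have hfactor : ∀ u, G u = u ^ (2 * k + 1) * Real.exp (-(1 / t * u)) *
      ((u ^ 2 - v ^ 2) * (densityRatio t u - densityRatio t v)) := by
    intro u
    simp only [hG, hvq]
    ring
  have hmono := densityRatio_strictMonoOn h0 h1
  have hGpos : ∀ u, 0 < u → u ≠ v → 0 < G u := by
    intro u hu huv
    rw [hfactor]
    refine mul_pos (by positivity) ?_
    rcases lt_or_gt_of_ne huv with h | h
    · exact mul_pos_of_neg_of_neg (by nlinarith) (sub_neg.2 (hmono hu hvpos h))
    · exact mul_pos (by nlinarith) (sub_pos.2 (hmono hvpos hu h))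
  have hGnonneg : ∀ u ∈ Ioi (0 : ℝ), 0 ≤ G u := by
    intro u hu
    by_cases huv : u = v
    · rw [hfactor, huv]; simp
    · exact (hGpos u hu huv).le
  have hpos : 0 < ∫ u in Ioi (0 : ℝ), G u := by
    rw [setIntegral_pos_iff_support_of_nonneg_ae
      (eventually_of_mem (self_mem_ae_restrict measurableSet_Ioi) hGnonneg) hGint]
    have hsub : Ioi v ⊆ Function.support G ∩ Ioi 0 := fun u hu =>
      ⟨(hGpos u (hvpos.trans hu) (ne_of_gt hu)).ne', hvpos.trans hu⟩
    exact lt_of_lt_of_le (by simp) (measure_mono hsub)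
  rw [hGval] at hpos
  have := pos_of_mul_pos_right hpos (by positivity)
  linarith

theorem signChange_kernelCoeff {t : ℝ} (h0 : 0 < t) (h1 : t < 1) :
    SignChange (kernelCoeff t) := by
  intro k hk
  have h := sq_mul_transferCoeff_lt h0 h1 k
  rw [kernelCoeff, sub_nonpos] at hk
  rw [kernelCoeff, sub_neg]
  calc t ^ (2 * (k + 1) + 2) = t ^ 2 * t ^ (2 * k + 2) := by ring
    _ ≤ _ := mul_le_mul_of_nonneg_left hk (sq_nonneg t)
    _ < _ := h

end HilbertKernel

theorem mainTheorem8 (t : ℝ) (ht : t ∈ Set.Ioo (-1 : ℝ) 1) (j : ℕ)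
    (x : ℝ) (hx : x ∈ Set.Ioo (0 : ℝ) 1) :
    (t ≠ 0 → 0 < (HilbertKernel.T₁^[j] (HilbertKernel.k₁II t)) x) ∧
      (HilbertKernel.T₁^[j] (HilbertKernel.k₁II t)) x <
        (HilbertKernel.T₁^[j] (HilbertKernel.k₁II 1)) x := by
  have habs : HilbertKernel.k₁II t = HilbertKernel.k₁II |t| := by
    rcases abs_choice t with h | h
    · rw [h]
    · ext y; rw [h, HilbertKernel.k₁II_neg]
  have h1 : |t| < 1 := abs_lt.2 ht
  have hf := HilbertKernel.oddSeries_k₁II (abs_nonneg t) h1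
  rw [habs]
  exact ⟨fun h0 => hf.iterate_pos (HilbertKernel.signChange_kernelCoeff (abs_pos.2 h0) h1)
      (HilbertKernel.tsum_kernelCoeff (abs_nonneg t) h1).ge j hx,
    hf.iterate_lt HilbertKernel.oddSeries_k₁II_one
      (HilbertKernel.kernelCoeff_lt_topCoeff (abs_nonneg t) h1) j hx⟩
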